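/- Let $\mathbb M^2$ be the space of real $2\times2$ matrices with inner product $\langle A,B\rangle=\operatorname{tr}A^\top B$ and norm $|A|=\langle A,A\rangle^{1/2}$, let $\operatorname{cof}A$ be the cofactor matrix of $A$, let $Z=\begin{bmatrix}0&-1\\1&0\end{bmatrix}$, and let $\mathcal D=\{(A,B)\in\mathbb M^2\times\mathbb M^2:\det A=1,\ \langle B,\operatorname{cof}A\rangle=0\}$ be the tangent bundle of $\mathrm{SL}(2,\mathbb R)$. Put $$X_1(A,B)=\tfrac12|B|^2,\qquad X_2(A,B)=\tfrac12\langle ZA-AZ,B\rangle,\qquad X_3(A,B)=\tfrac12\langle ZA+AZ,B\rangle$$ (these are the invariants of affine motion in the case $\kappa=0$). Let $A:\mathbb R\to\mathbb M^2$ be twice continuously differentiable with $\det A(t)=1$ for all $t\in\mathbb R$, and suppose that $\ddot A(t)=\lambda(t)\operatorname{cof}A(t)$ for all $t\in\mathbb R$, for some continuous $\lambda:\mathbb R\to\mathbb R$, with initial data $(A(0),\dot A(0))=(A_0,B_0)\in\mathcal D$. If $|A(t)|\to\infty$ as $t\to\infty$, then there exist $A_\infty,B_\infty\in\mathbb M^2$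 with $B_\infty\neq0$ and a constant $C$ such that, for $j=0,1,2$ and all $t\ge0$, $$\left|\left(\frac{d}{dt}\right)^j\left[A(t)-(B_\infty t+A_\infty)\right]\right|\le C(1+t)^{-1-j}.$$ If $\bar A_\infty,\bar B_\infty\in\mathbb M^2$ is any pair with $\lim_{t\to\infty}|A(t)-(\bar B_\infty t+\bar A_\infty)|=0$, then $(\bar A_\infty,\bar B_\infty)=(A_\infty,B_\infty)$. Moreover $$X_i(A_\infty,B_\infty)=X_i(A_0,B_0)\equiv X_i,\qquad i=1,2,3,$$ $$\langle B_\infty,\operatorname{cof}A_\infty\rangle=\det B_\infty=0,\qquad \det A_\infty=\frac{X_3^2-X_2^2}{2X_1}.$$ If $2X_1+X_2^2-X_3^2=0$, then $(A_\infty,B_\infty)=(A_0,B_0)\in\mathcal D$ and $A(t)=B_0t+A_0$ for all $t\in\mathbb R$. -/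

import Mathlib

open Filter Topology

-- The norm on matrices is the Frobenius (Euclidean) norm `|A| = (tr Aᵀ A)^(1/2)`.
attribute [local instance] Matrix.frobeniusNormedAddCommGroup Matrix.frobeniusNormedSpace

namespace AffineFluid

/-- Real `2 × 2` matrices. -/
abbrev M2 : Type := Matrix (Fin 2) (Fin 2) ℝ

/-- The Euclidean inner product `⟨A, B⟩ = tr Aᵀ B`. -/
def ip (A B : M2) : ℝ := (A.transpose * B).trace

/-- The rotation generator `Z`. -/
def Z : M2 := !![0, -1; 1, 0]

/-- The cofactor matrix, i.e. the transpose of the adjugate. -/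
def cof (A : M2) : M2 := A.adjugate.transpose

/-- The phase space: the tangent bundle of `SL(2, ℝ)` embedded in pairs of matrices. -/
def phaseSpace : Set (M2 × M2) := {p | p.1.det = 1 ∧ ip p.2 (cof p.1) = 0}

/-- The energy `X₁`. -/
noncomputable def X₁ (κ : ℝ) (A B : M2) : ℝ := 1 / 2 * ‖B‖ ^ 2 + κ / 2 * ‖A‖ ^ 2

/-- The invariant `X₂`. -/
noncomputable def X₂ (A B : M2) : ℝ := 1 / 2 * ip (Z * A - A * Z) B

/-- The invariant `X₃`. -/
noncomputable def X₃ (A B : M2) : ℝ := 1 / 2 * ip (Z * A + A * Z) B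

/-- `A` is a global solution, of class `C²` with values in `SL(2, ℝ)`, of
`A'' + κ A = λ cof A` for some continuous scalar function `λ` (the Lagrange multiplier). -/
structure IsAffineSolution (κ : ℝ) (A : ℝ → M2) : Prop where
  contDiff : ContDiff ℝ 2 A
  det_eq_one : ∀ t, (A t).det = 1
  ode : ∃ lam : ℝ → ℝ, Continuous lam ∧
    ∀ t, deriv (deriv A) t + κ • A t = lam t • cof (A t)

end AffineFluid

/-!
Let `λ` be the multiplier and `K = 2 X₁ + X₂² - X₃²`.  The three invariants are conserved, and
on all pairs of matrices
`det B |A|² + |B|² det A = X₃² - X₂² + ⟨A, B⟩ ⟨B, cof A⟩`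
(`det_mul_normSq_add`).  Along a solution `⟨A', cof A⟩ = 0`, so this reads `det A' |A|² = -K`, while
differentiating `⟨A', cof A⟩ = 0` gives `λ |A|² = -2 det A'`.  Hence `λ |A|⁴ = 2 K`
(`IsAffineSolution.multiplier_eq`): the multiplier depends on `|A|` and the conserved `K` only.

The function `|A|²` has second derivative `4 X₁ + 4 λ`, and `λ → 0` when `|A| → ∞`.  As `X₁ > 0` (else
`A` would be constant), `|A|` grows at least linearly (`IsAffineSolution.exists_linear_growth`), so
`|A''| = |λ| |A| = 2 |K| / |A|³` is `O((1 + t)⁻³)`.  Integrating twice from infinity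
(`exists_affine_asymptote`) produces the asymptote `t B∞ + A∞`.

For the limits, `|A'| → |B∞|` gives `X₁`, and `det A' |A|² = -K` gives `det B∞ = 0`.  The forms `X₂`,
`X₃` and `⟨B, cof A⟩` are bilinear in `(A, B)` and vanish at `(B∞, B∞)`, the last one because
`det B∞ = 0`, so they pass to the limit although `A` is unbounded (`tendsto_of_asymptote`).  The value
of `det A∞` comes from the displayed identity at `(A∞, B∞)`.  If `K = 0` then
`λ = 0` and the motion is affine.
-/

namespace AffineFluid

/-! ### Functions with decaying derivative -/

section Decay

variable {E : Type*} [NormedAddCommGroup E] [NormedSpace ℝ E]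

lemma hasDerivAt_div_one_add_pow (C : ℝ) (n : ℕ) {t : ℝ} (ht : 0 ≤ t) :
    HasDerivAt (fun x : ℝ => -C / (1 + x) ^ (n + 1))
      ((n + 1) * C / (1 + t) ^ (n + 2)) t := by
  have h1 : (1 + t) ≠ 0 := by positivity
  have h := (((hasDerivAt_id t).const_add 1).pow (n + 1)).inv (pow_ne_zero _ h1)
  refine (h.const_mul (-C)).congr_deriv ?_
  simp only [id, Nat.add_sub_cancel, Pi.pow_apply]
  push_cast
  field_simp
  ring

lemma norm_sub_le_of_deriv_decay {g g' : ℝ → E} {C : ℝ} (n : ℕ)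
    (hg : ∀ t, HasDerivAt g (g' t) t)
    (hb : ∀ t, 0 ≤ t → ‖g' t‖ ≤ (n + 1) * C / (1 + t) ^ (n + 2)) {s t : ℝ} (hs : 0 ≤ s)
    (hst : s ≤ t) :
    ‖g t - g s‖ ≤ C / (1 + s) ^ (n + 1) - C / (1 + t) ^ (n + 1) := by
  have := image_norm_le_of_norm_deriv_right_le_deriv_boundary' (a := s) (b := t)
    (f := fun x => g x - g s) (f' := g')
    (B := fun x => C / (1 + s) ^ (n + 1) + -C / (1 + x) ^ (n + 1))
    (B' := fun x => (n + 1) * C / (1 + x) ^ (n + 2))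
    (fun x _ => ((hg x).sub_const _).continuousAt.continuousWithinAt)
    (fun x _ => ((hg x).sub_const _).hasDerivWithinAt)
    (by simp [neg_div])
    (fun x hx => ((hasDerivAt_div_one_add_pow C n (hs.trans hx.1)).const_add
      _).continuousAt.continuousWithinAt)
    (fun x hx => ((hasDerivAt_div_one_add_pow C n (hs.trans hx.1)).const_add
      _).hasDerivWithinAt)
    (fun x hx => hb x (hs.trans hx.1))
    (Set.right_mem_Icc.2 hst)
  simpa [neg_div, sub_eq_add_neg] using this

lemma tendsto_div_one_add_pow (C : ℝ) (n : ℕ) :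
    Tendsto (fun t : ℝ => C / (1 + t) ^ (n + 1)) atTop (𝓝 0) :=
  tendsto_const_nhds.div_atTop
    ((tendsto_pow_atTop n.succ_ne_zero).comp (tendsto_atTop_add_const_left _ 1 tendsto_id))

/-- A derivative of order `(1 + t)⁻ⁿ⁻²` integrates from infinity to a remainder of order
`(1 + t)⁻ⁿ⁻¹`. -/
lemma exists_limit_of_deriv_decay [CompleteSpace E] {g g' : ℝ → E} {C : ℝ} (n : ℕ)
    (hg : ∀ t, HasDerivAt g (g' t) t) (hC : 0 ≤ C)
    (hb : ∀ t, 0 ≤ t → ‖g' t‖ ≤ (n + 1) * C / (1 + t) ^ (n + 2)) :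
    ∃ L : E, ∀ t, 0 ≤ t → ‖g t - L‖ ≤ C / (1 + t) ^ (n + 1) := by
  have key : ∀ s t, 0 ≤ s → s ≤ t → ‖g t - g s‖ ≤ C / (1 + s) ^ (n + 1) := fun s t hs hst =>
    (norm_sub_le_of_deriv_decay n hg hb hs hst).trans
      (sub_le_self _ (by have := hs.trans hst; positivity))
  have hcau : CauchySeq g := by
    refine Metric.cauchySeq_iff'.2 fun ε hε => ?_
    obtain ⟨s, h1, hs⟩ := (((tendsto_div_one_add_pow C n).eventually (gt_mem_nhds hε)).and
      (eventually_ge_atTop 0)).exists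
    exact ⟨s, fun t ht => by rw [dist_eq_norm]; exact (key s t hs ht).trans_lt h1⟩
  obtain ⟨L, hL⟩ := cauchySeq_tendsto_of_complete hcau
  refine ⟨L, fun s hs => ?_⟩
  rw [norm_sub_rev]
  exact le_of_tendsto (hL.sub_const (g s)).norm
    ((eventually_ge_atTop s).mono fun t ht => key s t hs ht)

/-- A curve with acceleration of order `(1 + t)⁻³` has an affine asymptote. -/
lemma exists_affine_asymptote [CompleteSpace E] {f f' f'' : ℝ → E} {C : ℝ}
    (hf : ∀ t, HasDerivAt f (f' t) t) (hf' : ∀ t, HasDerivAt f' (f'' t) t)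
    (hC : 0 ≤ C) (hb : ∀ t, 0 ≤ t → ‖f'' t‖ ≤ 2 * C / (1 + t) ^ 3) :
    ∃ a b : E, ∀ t, 0 ≤ t →
      ‖f t - (t • b + a)‖ ≤ C / (1 + t) ∧ ‖f' t - b‖ ≤ C / (1 + t) ^ 2 := by
  obtain ⟨b, hb'⟩ := exists_limit_of_deriv_decay 1 hf' hC (by
    intro t ht; refine (hb t ht).trans_eq ?_; norm_num)
  have hg : ∀ t, HasDerivAt (fun t => f t - t • b) (f' t - b) t := fun t => by
    simpa using (hf t).fun_sub ((hasDerivAt_id t).smul_const b)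
  obtain ⟨a, ha⟩ := exists_limit_of_deriv_decay 0 hg hC (by
    intro t ht; refine (hb' t ht).trans_eq ?_; norm_num)
  exact ⟨a, b, fun t ht => ⟨by simpa [sub_sub] using ha t ht, hb' t ht⟩⟩

lemma tendsto_atTop_of_deriv_ge {f f' : ℝ → ℝ} {c : ℝ} (hc : 0 < c)
    (hf : ∀ t, HasDerivAt f (f' t) t) (hb : ∀ᶠ t in atTop, c ≤ f' t) :
    Tendsto f atTop atTop := by
  obtain ⟨T, hT⟩ := eventually_atTop.1 hb
  have hmono : ∀ t, T ≤ t → c * (t - T) ≤ f t - f T := fun t ht =>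
    (convex_Ici T).mul_sub_le_image_sub_of_le_deriv
      (fun x _ => (hf x).continuousAt.continuousWithinAt)
      (fun x _ => (hf x).differentiableAt.differentiableWithinAt)
      (fun x hx => by rw [(hf x).deriv]; exact hT x (interior_subset hx))
      T Set.self_mem_Ici t ht ht
  have hlin : Tendsto (fun t : ℝ => f T + c * (t - T)) atTop atTop :=
    tendsto_atTop_add_const_left _ _
      ((tendsto_atTop_add_const_right _ (-T) tendsto_id).const_mul_atTop hc)
  exact tendsto_atTop_mono' _ ((eventually_ge_atTop T).mono fun t ht => by
    linarith [hmono t ht]) hlin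

end Decay

/-! ### Algebra of two by two matrices -/

lemma ip_eq (A B : M2) :
    ip A B = A 0 0 * B 0 0 + A 0 1 * B 0 1 + A 1 0 * B 1 0 + A 1 1 * B 1 1 := by
  simp only [ip, Matrix.trace, Matrix.diag, Matrix.mul_apply, Matrix.transpose_apply,
    Fin.sum_univ_two]
  ring

lemma cof_eq (A : M2) : cof A = !![A 1 1, -A 1 0; -A 0 1, A 0 0] := by
  ext i j
  fin_cases i <;> fin_cases j <;> simp [cof, Matrix.adjugate_fin_two]

lemma ip_cof_eq (A B : M2) :
    ip B (cof A) = B 0 0 * A 1 1 - B 0 1 * A 1 0 - B 1 0 * A 0 1 + B 1 1 * A 0 0 := by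
  simp [ip_eq, cof_eq]
  ring

lemma norm_sq_eq (A : M2) :
    ‖A‖ ^ 2 = A 0 0 ^ 2 + A 0 1 ^ 2 + A 1 0 ^ 2 + A 1 1 ^ 2 := by
  rw [Matrix.frobenius_norm_def, ← Real.rpow_natCast, ← Real.rpow_mul (by positivity)]
  simp [Fin.sum_univ_two]
  ring

lemma X₁_eq (A B : M2) : X₁ 0 A B = 1 / 2 * ‖B‖ ^ 2 := by simp [X₁]

lemma X₂_eq (A B : M2) :
    X₂ A B = 1 / 2 * (-(A 0 1 + A 1 0) * (B 0 0 - B 1 1)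
      + (A 0 0 - A 1 1) * (B 0 1 + B 1 0)) := by
  simp only [X₂, ip_eq, Z, Matrix.mul_apply, Fin.sum_univ_two, Matrix.sub_apply,
    Matrix.of_apply, Matrix.cons_val]
  ring

lemma X₃_eq (A B : M2) :
    X₃ A B = 1 / 2 * ((A 0 1 - A 1 0) * (B 0 0 + B 1 1)
      + (A 0 0 + A 1 1) * (B 1 0 - B 0 1)) := by
  simp only [X₃, ip_eq, Z, Matrix.mul_apply, Fin.sum_univ_two, Matrix.add_apply,
    Matrix.of_apply, Matrix.cons_val]
  ring

/-- The polynomial identity linking the invariants to `det A` and `det B`; up to factors it is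
Lagrange's identity for the conformal and the anticonformal parts of `A` and `B`. -/
lemma det_mul_normSq_add (A B : M2) :
    B.det * ‖A‖ ^ 2 + ‖B‖ ^ 2 * A.det =
      X₃ A B ^ 2 - X₂ A B ^ 2 + ip A B * ip B (cof A) := by
  rw [norm_sq_eq, norm_sq_eq, X₃_eq, X₂_eq, ip_eq A B, ip_cof_eq, Matrix.det_fin_two,
    Matrix.det_fin_two]
  ring

lemma two_det_le_norm_sq (A : M2) : 2 * A.det ≤ ‖A‖ ^ 2 := by
  rw [norm_sq_eq, Matrix.det_fin_two]
  nlinarith [sq_nonneg (A 0 0 - A 1 1), sq_nonneg (A 0 1 + A 1 0)]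

lemma norm_cof (A : M2) : ‖cof A‖ = ‖A‖ := by
  have : ‖cof A‖ ^ 2 = ‖A‖ ^ 2 := by
    rw [norm_sq_eq, norm_sq_eq, cof_eq]
    simp
    ring
  exact (sq_eq_sq₀ (norm_nonneg _) (norm_nonneg _)).1 this

/-- The entry `A ↦ A i j` as a continuous linear form for the Frobenius norm. -/
noncomputable def entryCLM (i j : Fin 2) : M2 →L[ℝ] ℝ :=
  LinearMap.toContinuousLinearMap (Matrix.entryLinearMap ℝ ℝ i j)

@[simp] lemma entryCLM_apply (i j : Fin 2) (A : M2) : entryCLM i j A = A i j := rfl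

lemma tendsto_entry {l : Filter ℝ} {f : ℝ → M2} {A : M2} (hf : Tendsto f l (𝓝 A)) (i j : Fin 2) :
    Tendsto (fun t => f t i j) l (𝓝 (A i j)) :=
  ((entryCLM i j).continuous.tendsto A).comp hf

lemma hasDerivAt_entry {f : ℝ → M2} {f' : M2} {t : ℝ} (hf : HasDerivAt f f' t) (i j : Fin 2) :
    HasDerivAt (fun t => f t i j) (f' i j) t :=
  (entryCLM i j).hasFDerivAt.comp_hasDerivAt t hf

/-! ### Conserved quantities and the multiplier -/

namespace IsAffineSolution

variable {A : ℝ → M2}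

lemma hasDerivAt (hA : IsAffineSolution 0 A) (t : ℝ) : HasDerivAt A (deriv A t) t :=
  (hA.contDiff.differentiable (by norm_num) t).hasDerivAt

lemma hasDerivAt_deriv (hA : IsAffineSolution 0 A) (t : ℝ) :
    HasDerivAt (deriv A) (deriv (deriv A) t) t :=
  ((hA.contDiff.differentiable_deriv_two) t).hasDerivAt

/-- The velocity is tangent to `SL(2, ℝ)`. -/
lemma ip_deriv_cof (hA : IsAffineSolution 0 A) (t : ℝ) : ip (deriv A t) (cof (A t)) = 0 := by
  have e := fun i j => hasDerivAt_entry (hA.hasDerivAt t) i j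
  have h := ((e 0 0).mul (e 1 1)).sub ((e 0 1).mul (e 1 0))
  have hc : HasDerivAt (fun _ : ℝ => (1 : ℝ)) 0 t := hasDerivAt_const t 1
  have := h.unique (hc.congr_of_eventuallyEq (Eventually.of_forall fun s => by
    simpa [Matrix.det_fin_two] using hA.det_eq_one s))
  rw [ip_cof_eq]
  linarith

variable {lam : ℝ → ℝ}

lemma hasDerivAt_deriv_entries (hA : IsAffineSolution 0 A)
    (hl : ∀ t, deriv (deriv A) t = lam t • cof (A t)) (t : ℝ) :
    HasDerivAt (fun s => deriv A s 0 0) (lam t * A t 1 1) t ∧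
    HasDerivAt (fun s => deriv A s 0 1) (-lam t * A t 1 0) t ∧
    HasDerivAt (fun s => deriv A s 1 0) (-lam t * A t 0 1) t ∧
    HasDerivAt (fun s => deriv A s 1 1) (lam t * A t 0 0) t := by
  have e := fun i j => hasDerivAt_entry (hA.hasDerivAt_deriv t) i j
  simp only [hl, cof_eq] at e
  exact ⟨by simpa using e 0 0, by simpa using e 0 1, by simpa using e 1 0, by simpa using e 1 1⟩

lemma eq_apply_zero_of_hasDerivAt_zero {f : ℝ → ℝ} (hf : ∀ t, HasDerivAt f 0 t) (t : ℝ) :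
    f t = f 0 :=
  is_const_of_deriv_eq_zero (fun t => (hf t).differentiableAt) (fun t => (hf t).deriv) t 0

lemma X₁_conserved (hA : IsAffineSolution 0 A)
    (hl : ∀ t, deriv (deriv A) t = lam t • cof (A t)) (t : ℝ) :
    X₁ 0 (A t) (deriv A t) = X₁ 0 (A 0) (deriv A 0) := by
  refine eq_apply_zero_of_hasDerivAt_zero (f := fun t => X₁ 0 (A t) (deriv A t)) (fun t => ?_) t
  simp only [X₁_eq, norm_sq_eq]
  obtain ⟨h00, h01, h10, h11⟩ := hA.hasDerivAt_deriv_entries hl t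
  have h := (((h00.pow 2).add (h01.pow 2)).add (h10.pow 2)).add (h11.pow 2) |>.const_mul (1 / 2)
  refine (h).congr_deriv ?_
  have := hA.ip_deriv_cof t
  rw [ip_cof_eq] at this
  push_cast
  linear_combination lam t * this

lemma X₂_conserved (hA : IsAffineSolution 0 A)
    (hl : ∀ t, deriv (deriv A) t = lam t • cof (A t)) (t : ℝ) :
    X₂ (A t) (deriv A t) = X₂ (A 0) (deriv A 0) := by
  refine eq_apply_zero_of_hasDerivAt_zero (f := fun t => X₂ (A t) (deriv A t)) (fun t => ?_) t
  simp only [X₂_eq]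
  obtain ⟨h00, h01, h10, h11⟩ := hA.hasDerivAt_deriv_entries hl t
  have e := fun i j => hasDerivAt_entry (hA.hasDerivAt t) i j
  refine (((((e 0 1).add (e 1 0)).neg.mul (h00.sub h11)).add
    (((e 0 0).sub (e 1 1)).mul (h01.add h10))).const_mul (1 / 2)).congr_deriv ?_
  simp only [Pi.add_apply, Pi.sub_apply, Pi.neg_apply]
  ring

lemma X₃_conserved (hA : IsAffineSolution 0 A)
    (hl : ∀ t, deriv (deriv A) t = lam t • cof (A t)) (t : ℝ) :
    X₃ (A t) (deriv A t) = X₃ (A 0) (deriv A 0) := by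
  refine eq_apply_zero_of_hasDerivAt_zero (f := fun t => X₃ (A t) (deriv A t)) (fun t => ?_) t
  simp only [X₃_eq]
  obtain ⟨h00, h01, h10, h11⟩ := hA.hasDerivAt_deriv_entries hl t
  have e := fun i j => hasDerivAt_entry (hA.hasDerivAt t) i j
  refine (((((e 0 1).sub (e 1 0)).mul (h00.add h11)).add
    (((e 0 0).add (e 1 1)).mul (h10.sub h01))).const_mul (1 / 2)).congr_deriv ?_
  simp only [Pi.add_apply, Pi.sub_apply]
  ring

/-- Obtained by differentiating the tangency condition. -/
lemma multiplier_mul_norm_sq (hA : IsAffineSolution 0 A)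
    (hl : ∀ t, deriv (deriv A) t = lam t • cof (A t)) (t : ℝ) :
    lam t * ‖A t‖ ^ 2 = -2 * (deriv A t).det := by
  obtain ⟨h00, h01, h10, h11⟩ := hA.hasDerivAt_deriv_entries hl t
  have e := fun i j => hasDerivAt_entry (hA.hasDerivAt t) i j
  have h := (((h00.mul (e 1 1)).sub (h01.mul (e 1 0))).sub (h10.mul (e 0 1))).add
    (h11.mul (e 0 0))
  have hc : HasDerivAt (fun _ : ℝ => (0 : ℝ)) 0 t := hasDerivAt_const t 0
  have := h.unique (hc.congr_of_eventuallyEq (Eventually.of_forall fun s => by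
    simpa [ip_cof_eq] using hA.ip_deriv_cof s))
  rw [norm_sq_eq, Matrix.det_fin_two]
  linarith

lemma det_deriv_mul_norm_sq (hA : IsAffineSolution 0 A)
    (hl : ∀ t, deriv (deriv A) t = lam t • cof (A t)) (t : ℝ) :
    (deriv A t).det * ‖A t‖ ^ 2 = -(2 * X₁ 0 (A 0) (deriv A 0) + X₂ (A 0) (deriv A 0) ^ 2
      - X₃ (A 0) (deriv A 0) ^ 2) := by
  have h := det_mul_normSq_add (A t) (deriv A t)
  rw [hA.ip_deriv_cof, hA.det_eq_one, hA.X₂_conserved hl, hA.X₃_conserved hl] at h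
  rw [← hA.X₁_conserved hl t, X₁_eq]
  linarith

lemma multiplier_eq (hA : IsAffineSolution 0 A)
    (hl : ∀ t, deriv (deriv A) t = lam t • cof (A t)) (t : ℝ) :
    lam t * ‖A t‖ ^ 4 = 2 * (2 * X₁ 0 (A 0) (deriv A 0) + X₂ (A 0) (deriv A 0) ^ 2
      - X₃ (A 0) (deriv A 0) ^ 2) := by
  linear_combination ‖A t‖ ^ 2 * hA.multiplier_mul_norm_sq hl t
    - 2 * hA.det_deriv_mul_norm_sq hl t

lemma norm_pos (hA : IsAffineSolution 0 A) (t : ℝ) : 0 < ‖A t‖ := by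
  have := two_det_le_norm_sq (A t)
  rw [hA.det_eq_one] at this
  by_contra h
  have h0 : ‖A t‖ = 0 := le_antisymm (not_lt.1 h) (norm_nonneg _)
  norm_num [h0] at this

/-! ### Linear growth -/

lemma hasDerivAt_norm_sq (hA : IsAffineSolution 0 A) (t : ℝ) :
    HasDerivAt (fun s => ‖A s‖ ^ 2) (2 * ip (A t) (deriv A t)) t := by
  simp only [norm_sq_eq]
  have e := fun i j => hasDerivAt_entry (hA.hasDerivAt t) i j
  refine (((((e 0 0).pow 2).add ((e 0 1).pow 2)).add ((e 1 0).pow 2)).add ((e 1 1).pow 2)).congr_deriv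
    ?_
  rw [ip_eq]
  push_cast
  ring

lemma hasDerivAt_ip_deriv (hA : IsAffineSolution 0 A)
    (hl : ∀ t, deriv (deriv A) t = lam t • cof (A t)) (t : ℝ) :
    HasDerivAt (fun s => 2 * ip (A s) (deriv A s))
      (4 * X₁ 0 (A 0) (deriv A 0) + 4 * lam t) t := by
  obtain ⟨h00, h01, h10, h11⟩ := hA.hasDerivAt_deriv_entries hl t
  have e := fun i j => hasDerivAt_entry (hA.hasDerivAt t) i j
  simp only [ip_eq]
  refine ((((((e 0 0).mul h00).add ((e 0 1).mul h01)).add ((e 1 0).mul h10)).add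
    ((e 1 1).mul h11)).const_mul 2).congr_deriv ?_
  have hd := hA.det_eq_one t
  rw [Matrix.det_fin_two] at hd
  rw [← hA.X₁_conserved hl t, X₁_eq, norm_sq_eq]
  linear_combination 4 * lam t * hd

lemma X₁_pos (hA : IsAffineSolution 0 A)
    (hl : ∀ t, deriv (deriv A) t = lam t • cof (A t))
    (hinf : Tendsto (fun t : ℝ => ‖A t‖) atTop atTop) : 0 < X₁ 0 (A 0) (deriv A 0) := by
  refine lt_of_le_of_ne (by rw [X₁_eq]; positivity) fun h0 => ?_
  have hz : ∀ t, deriv A t = 0 := fun t => by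
    have := hA.X₁_conserved hl t
    rw [← h0, X₁_eq] at this
    simpa using this
  have hc : ∀ t, A t = A 0 := fun t =>
    is_const_of_deriv_eq_zero (fun t => (hA.hasDerivAt t).differentiableAt) hz t 0
  simp only [hc] at hinf
  exact not_tendsto_const_atTop _ _ hinf

lemma tendsto_multiplier (hA : IsAffineSolution 0 A)
    (hl : ∀ t, deriv (deriv A) t = lam t • cof (A t))
    (hinf : Tendsto (fun t : ℝ => ‖A t‖) atTop atTop) : Tendsto lam atTop (𝓝 0) := by
  have h : lam = fun t => 2 * (2 * X₁ 0 (A 0) (deriv A 0) + X₂ (A 0) (deriv A 0) ^ 2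
      - X₃ (A 0) (deriv A 0) ^ 2) / ‖A t‖ ^ 4 := by
    funext t
    rw [eq_div_iff (pow_pos (hA.norm_pos t) 4).ne', hA.multiplier_eq hl]
  rw [h]
  exact tendsto_const_nhds.div_atTop ((tendsto_pow_atTop four_ne_zero).comp hinf)

lemma exists_linear_growth (hA : IsAffineSolution 0 A)
    (hl : ∀ t, deriv (deriv A) t = lam t • cof (A t))
    (hinf : Tendsto (fun t : ℝ => ‖A t‖) atTop atTop) :
    ∃ c : ℝ, 0 < c ∧ ∀ t, 0 ≤ t → c * (1 + t) ≤ ‖A t‖ := by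
  set x := X₁ 0 (A 0) (deriv A 0) with hx
  have hx0 : 0 < x := hA.X₁_pos hl hinf
  -- `h = |A|² - x (1 + t)²` has second derivative `4 x + 4 λ - 2 x`, which is eventually `≥ x`.
  have hd1 : ∀ t : ℝ, HasDerivAt (fun s => ‖A s‖ ^ 2 - x * (1 + s) ^ 2)
      (2 * ip (A t) (deriv A t) - 2 * x * (1 + t)) t := fun t => by
    refine ((hA.hasDerivAt_norm_sq t).sub
      ((((hasDerivAt_id t).const_add 1).pow 2).const_mul x)).congr_deriv ?_
    simp
    ring
  have hd2 : ∀ t : ℝ, HasDerivAt (fun s => 2 * ip (A s) (deriv A s) - 2 * x * (1 + s))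
      (4 * x + 4 * lam t - 2 * x) t := fun t => by
    refine ((hA.hasDerivAt_ip_deriv hl t).sub
      (((hasDerivAt_id t).const_add 1).const_mul (2 * x))).congr_deriv ?_
    simp [hx]
  have hl0 := (hA.tendsto_multiplier hl hinf).eventually (lt_mem_nhds (show -(x / 4) < 0 by linarith))
  have h1 := tendsto_atTop_of_deriv_ge hx0 hd2 (hl0.mono fun t ht => by linarith)
  have h2 := tendsto_atTop_of_deriv_ge one_pos hd1 (h1.eventually_ge_atTop 1)
  obtain ⟨T, hT⟩ := eventually_atTop.1 (h2.eventually_ge_atTop 0)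
  -- Before time `T` the bound `|A| ≥ 1`, from `|A|² ≥ 2 det A`, suffices.
  have hone : ∀ t, 1 ≤ ‖A t‖ := fun t => by
    have := two_det_le_norm_sq (A t)
    rw [hA.det_eq_one] at this
    nlinarith [hA.norm_pos t]
  refine ⟨min (Real.sqrt x) (1 / (1 + |T|)), lt_min (Real.sqrt_pos.2 hx0) (by positivity),
    fun t ht => ?_⟩
  rcases le_total T t with h | h
  · refine (mul_le_mul_of_nonneg_right (min_le_left _ _) (by linarith)).trans ?_
    refine abs_le_of_sq_le_sq' ?_ (norm_nonneg _) |>.2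
    rw [mul_pow, Real.sq_sqrt hx0.le]
    linarith [hT t h]
  · refine (mul_le_mul_of_nonneg_right (min_le_right _ _) (by linarith)).trans
      (le_trans ?_ (hone t))
    rw [one_div_mul_eq_div, div_le_one (by positivity)]
    linarith [le_abs_self T]

lemma exists_acceleration_decay (hA : IsAffineSolution 0 A)
    (hl : ∀ t, deriv (deriv A) t = lam t • cof (A t))
    (hinf : Tendsto (fun t : ℝ => ‖A t‖) atTop atTop) :
    ∃ C : ℝ, 0 ≤ C ∧ ∀ t, 0 ≤ t → ‖deriv (deriv A) t‖ ≤ 2 * C / (1 + t) ^ 3 := by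
  obtain ⟨c, hc, hgr⟩ := hA.exists_linear_growth hl hinf
  set K := 2 * X₁ 0 (A 0) (deriv A 0) + X₂ (A 0) (deriv A 0) ^ 2
      - X₃ (A 0) (deriv A 0) ^ 2
  refine ⟨|K| / c ^ 3, by positivity, fun t ht => ?_⟩
  have hn := hA.norm_pos t
  have h : ‖deriv (deriv A) t‖ = 2 * |K| / ‖A t‖ ^ 3 := by
    rw [hl, norm_smul, norm_cof, Real.norm_eq_abs, eq_div_iff (by positivity)]
    have := congrArg abs (hA.multiplier_eq hl t)
    rw [abs_mul, abs_mul, abs_of_pos (pow_pos hn 4), abs_two] at this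
    rw [← this]
    ring
  calc ‖deriv (deriv A) t‖ = 2 * |K| / ‖A t‖ ^ 3 := h
    _ ≤ 2 * |K| / (c * (1 + t)) ^ 3 := by
      gcongr
      exact hgr t ht
    _ = 2 * (|K| / c ^ 3) / (1 + t) ^ 3 := by
      rw [mul_pow]
      field_simp

end IsAffineSolution

/-! ### Passing to the limit along an asymptote -/

lemma tendsto_sub_smul {f : ℝ → M2} {a b : M2}
    (h : Tendsto (fun t => ‖f t - (t • b + a)‖) atTop (𝓝 0)) :
    Tendsto (fun t => f t - t • b) atTop (𝓝 a) := by
  have := (tendsto_zero_iff_norm_tendsto_zero.2 h).add_const a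
  refine ((zero_add a) ▸ this).congr fun t => ?_
  abel

lemma asymptote_unique {f : ℝ → M2} {a b a' b' : M2}
    (h : Tendsto (fun t => ‖f t - (t • b + a)‖) atTop (𝓝 0))
    (h' : Tendsto (fun t => ‖f t - (t • b' + a')‖) atTop (𝓝 0)) : (a', b') = (a, b) := by
  have hd : Tendsto (fun t : ℝ => t • (b - b')) atTop (𝓝 (a' - a)) := by
    refine ((tendsto_sub_smul h').sub (tendsto_sub_smul h)).congr fun t => ?_
    rw [smul_sub]
    abel
  have hb : b - b' = 0 := by
    have h1 := (tendsto_inv_atTop_zero (𝕜 := ℝ)).smul hd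
    rw [zero_smul] at h1
    refine tendsto_nhds_unique (tendsto_const_nhds.congr' ?_) h1
    filter_upwards [eventually_ne_atTop 0] with t ht
    rw [smul_smul, inv_mul_cancel₀ ht, one_smul]
  rw [hb] at hd
  simp only [smul_zero] at hd
  have ha := tendsto_nhds_unique hd tendsto_const_nhds
  rw [sub_eq_zero.1 hb, sub_eq_zero.1 ha]

/-- If `β(A, B)` is bilinear and `β(b, b) = 0`, then `β(f, g) → β(a, b)` for curves `f ≈ t b + a`
and `g ≈ b`, because `β(f, g) = β(f - t b, g) + β(b, t (g - b))`.
Bilinearity enters as this splitting only. -/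
lemma tendsto_of_asymptote {β : M2 → M2 → ℝ}
    (hβ : ∀ (A B C : M2) (t : ℝ), β A B = β (A - t • C) B + β C (t • (B - C)) + t * β C C)
    (hcont : ∀ (u v : ℝ → M2) (p q : M2), Tendsto u atTop (𝓝 p) → Tendsto v atTop (𝓝 q) →
      Tendsto (fun t => β (u t) (v t)) atTop (𝓝 (β p q)))
    {f g : ℝ → M2} {a b : M2} (hf : Tendsto (fun t => f t - t • b) atTop (𝓝 a))
    (hg : Tendsto g atTop (𝓝 b)) (hgt : Tendsto (fun t => t • (g t - b)) atTop (𝓝 0))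
    (hb : β b b = 0) : Tendsto (fun t => β (f t) (g t)) atTop (𝓝 (β a b)) := by
  have h0 : β b 0 = 0 := by
    have := hβ b b b 0
    simp only [sub_self, smul_zero, hb, zero_mul, zero_smul, sub_zero] at this
    linarith
  have h := (hcont _ _ _ _ hf hg).add (hcont (fun _ => b) _ b _ tendsto_const_nhds hgt)
  rw [h0, add_zero] at h
  refine h.congr fun t => ?_
  rw [hβ (f t) (g t) b t, hb]
  ring

lemma tendsto_X₂ (u v : ℝ → M2) (p q : M2) (hu : Tendsto u atTop (𝓝 p))
    (hv : Tendsto v atTop (𝓝 q)) :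
    Tendsto (fun t => X₂ (u t) (v t)) atTop (𝓝 (X₂ p q)) := by
  have e := tendsto_entry hu
  have e' := tendsto_entry hv
  simp only [X₂_eq]
  exact ((((e 0 1).add (e 1 0)).neg.mul ((e' 0 0).sub (e' 1 1))).add
    (((e 0 0).sub (e 1 1)).mul ((e' 0 1).add (e' 1 0)))).const_mul _

lemma tendsto_X₃ (u v : ℝ → M2) (p q : M2) (hu : Tendsto u atTop (𝓝 p))
    (hv : Tendsto v atTop (𝓝 q)) :
    Tendsto (fun t => X₃ (u t) (v t)) atTop (𝓝 (X₃ p q)) := by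
  have e := tendsto_entry hu
  have e' := tendsto_entry hv
  simp only [X₃_eq]
  exact ((((e 0 1).sub (e 1 0)).mul ((e' 0 0).add (e' 1 1))).add
    (((e 0 0).add (e 1 1)).mul ((e' 1 0).sub (e' 0 1)))).const_mul _

lemma tendsto_ip_cof (u v : ℝ → M2) (p q : M2) (hu : Tendsto u atTop (𝓝 p))
    (hv : Tendsto v atTop (𝓝 q)) :
    Tendsto (fun t => ip (v t) (cof (u t))) atTop (𝓝 (ip q (cof p))) := by
  have e := tendsto_entry hu
  have e' := tendsto_entry hv
  simp only [ip_cof_eq]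
  exact ((((e' 0 0).mul (e 1 1)).sub ((e' 0 1).mul (e 1 0))).sub ((e' 1 0).mul (e 0 1))).add
    ((e' 1 1).mul (e 0 0))

lemma tendsto_det {v : ℝ → M2} {q : M2} (hv : Tendsto v atTop (𝓝 q)) :
    Tendsto (fun t => (v t).det) atTop (𝓝 q.det) := by
  have e := tendsto_entry hv
  simp only [Matrix.det_fin_two]
  exact ((e 0 0).mul (e 1 1)).sub ((e 0 1).mul (e 1 0))

end AffineFluid

open AffineFluid in
theorem theorem12p3 (A : ℝ → AffineFluid.M2) (A₀ B₀ : AffineFluid.M2)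
    (hD : (A₀, B₀) ∈ AffineFluid.phaseSpace)
    (hA : AffineFluid.IsAffineSolution 0 A)
    (hA₀ : A 0 = A₀) (hB₀ : deriv A 0 = B₀)
    (hinf : Tendsto (fun t : ℝ => ‖A t‖) atTop atTop) :
    ∃ Ainf Binf : AffineFluid.M2,
      Binf ≠ 0 ∧
      (∃ C : ℝ, ∀ j : ℕ, j ≤ 2 → ∀ t : ℝ, 0 ≤ t →
        ‖iteratedDeriv j (fun s : ℝ => A s - (s • Binf + Ainf)) t‖ ≤ C / (1 + t) ^ (1 + j)) ∧
      (∀ Abar Bbar : AffineFluid.M2,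
        Tendsto (fun t : ℝ => ‖A t - (t • Bbar + Abar)‖) atTop (𝓝 0) →
          (Abar, Bbar) = (Ainf, Binf)) ∧
      AffineFluid.X₁ 0 Ainf Binf = AffineFluid.X₁ 0 A₀ B₀ ∧
      AffineFluid.X₂ Ainf Binf = AffineFluid.X₂ A₀ B₀ ∧
      AffineFluid.X₃ Ainf Binf = AffineFluid.X₃ A₀ B₀ ∧
      AffineFluid.ip Binf (AffineFluid.cof Ainf) = 0 ∧
      Binf.det = 0 ∧
      Ainf.det = (AffineFluid.X₃ A₀ B₀ ^ 2 - AffineFluid.X₂ A₀ B₀ ^ 2) /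
        (2 * AffineFluid.X₁ 0 A₀ B₀) ∧
      (2 * AffineFluid.X₁ 0 A₀ B₀ + AffineFluid.X₂ A₀ B₀ ^ 2 - AffineFluid.X₃ A₀ B₀ ^ 2 = 0 →
        (Ainf, Binf) = (A₀, B₀) ∧ (Ainf, Binf) ∈ AffineFluid.phaseSpace ∧
        ∀ t : ℝ, A t = t • B₀ + A₀) := by
  obtain ⟨lam, -, hode⟩ := hA.ode
  have hl : ∀ t, deriv (deriv A) t = lam t • cof (A t) := fun t => by simpa using hode t
  subst hA₀ hB₀
  have hX₁ := hA.X₁_pos hl hinf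
  obtain ⟨C, hC, hacc⟩ := hA.exists_acceleration_decay hl hinf
  obtain ⟨a, b, hab⟩ := exists_affine_asymptote hA.hasDerivAt hA.hasDerivAt_deriv hC hacc
  have hasym : Tendsto (fun t => ‖A t - (t • b + a)‖) atTop (𝓝 0) :=
    squeeze_zero' (Eventually.of_forall fun t => norm_nonneg _)
      ((eventually_ge_atTop 0).mono fun t ht => (hab t ht).1)
      (by simpa using tendsto_div_one_add_pow C 0)
  have hf := tendsto_sub_smul hasym
  have hgt : Tendsto (fun t => t • (deriv A t - b)) atTop (𝓝 0) := by
    refine squeeze_zero_norm' ((eventually_ge_atTop 0).mono fun t ht => ?_)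
      (by simpa using tendsto_div_one_add_pow C 0)
    rw [norm_smul, Real.norm_of_nonneg ht]
    calc t * ‖deriv A t - b‖ ≤ (1 + t) * (C / (1 + t) ^ 2) :=
          mul_le_mul (by linarith) (hab t ht).2 (norm_nonneg _) (by linarith)
      _ = C / (1 + t) := by field_simp
  have hg : Tendsto (deriv A) atTop (𝓝 b) := by
    refine tendsto_iff_norm_sub_tendsto_zero.2 ?_
    exact squeeze_zero' (Eventually.of_forall fun t => norm_nonneg _)
      ((eventually_ge_atTop 0).mono fun t ht => (hab t ht).2) (tendsto_div_one_add_pow C 1)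
  have h1 : X₁ 0 a b = X₁ 0 (A 0) (deriv A 0) := by
    have h : Tendsto (fun t => X₁ 0 (A t) (deriv A t)) atTop (𝓝 (X₁ 0 a b)) := by
      simp only [X₁_eq]
      exact (hg.norm.pow 2).const_mul _
    simp only [hA.X₁_conserved hl] at h
    exact tendsto_nhds_unique h tendsto_const_nhds
  have h2 : X₂ a b = X₂ (A 0) (deriv A 0) := by
    have h := tendsto_of_asymptote (β := X₂)
      (fun A B C t => by simp only [X₂_eq, Matrix.sub_apply, Matrix.smul_apply, smul_eq_mul]; ring)
      tendsto_X₂ hf hg hgt (by rw [X₂_eq]; ring)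
    simp only [hA.X₂_conserved hl] at h
    exact tendsto_nhds_unique h tendsto_const_nhds
  have h3 : X₃ a b = X₃ (A 0) (deriv A 0) := by
    have h := tendsto_of_asymptote (β := X₃)
      (fun A B C t => by simp only [X₃_eq, Matrix.sub_apply, Matrix.smul_apply, smul_eq_mul]; ring)
      tendsto_X₃ hf hg hgt (by rw [X₃_eq]; ring)
    simp only [hA.X₃_conserved hl] at h
    exact tendsto_nhds_unique h tendsto_const_nhds
  have hdet : b.det = 0 := by
    have h : Tendsto (fun t => (deriv A t).det) atTop (𝓝 0) := by
      have e : ∀ t, -(2 * X₁ 0 (A 0) (deriv A 0) + X₂ (A 0) (deriv A 0) ^ 2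
          - X₃ (A 0) (deriv A 0) ^ 2) / ‖A t‖ ^ 2 = (deriv A t).det := fun t => by
        rw [← hA.det_deriv_mul_norm_sq hl t, mul_div_cancel_right₀ _ (pow_pos (hA.norm_pos t) 2).ne']
      exact (tendsto_const_nhds.div_atTop
        ((tendsto_pow_atTop two_ne_zero).comp hinf)).congr e
    exact tendsto_nhds_unique (tendsto_det hg) h
  have htan : ip b (cof a) = 0 := by
    have h := tendsto_of_asymptote (β := fun A B => ip B (cof A))
      (fun A B C t => by
        simp only [ip_cof_eq, Matrix.sub_apply, Matrix.smul_apply, smul_eq_mul]; ring)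
      tendsto_ip_cof hf hg hgt (by rw [Matrix.det_fin_two] at hdet; rw [ip_cof_eq]; linarith)
    simp only [hA.ip_deriv_cof] at h
    exact tendsto_nhds_unique h tendsto_const_nhds
  have huniq : ∀ a' b' : M2, Tendsto (fun t : ℝ => ‖A t - (t • b' + a')‖) atTop (𝓝 0) →
      (a', b') = (a, b) := fun a' b' h => asymptote_unique hasym h
  refine ⟨a, b, ?_, ⟨2 * C, ?_⟩, huniq, h1, h2, h3, htan, hdet, ?_, ?_⟩
  · rintro rfl
    rw [← h1, X₁_eq] at hX₁
    simp at hX₁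
  · have hd : deriv (fun s : ℝ => A s - (s • b + a)) = fun s => deriv A s - b := by
      funext s
      have := (hA.hasDerivAt s).fun_sub (((hasDerivAt_id s).smul_const b).add_const a)
      rw [one_smul] at this
      exact this.deriv
    intro j hj t ht
    have hdouble : ∀ n : ℕ, C / (1 + t) ^ n ≤ 2 * C / (1 + t) ^ n := fun n => by
      gcongr
      linarith
    interval_cases j
    · rw [iteratedDeriv_zero]
      exact (hab t ht).1.trans (by simpa using hdouble 1)
    · rw [iteratedDeriv_one]
      exact (congrArg norm (congrFun hd t)).trans_le ((hab t ht).2.trans (hdouble 2))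
    · rw [iteratedDeriv_succ, iteratedDeriv_one]
      have h2 : deriv (deriv fun s : ℝ => A s - (s • b + a)) t = deriv (deriv A) t :=
        (congrArg (fun f => deriv f t) hd).trans (deriv_sub_const b)
      exact (congrArg norm h2).trans_le (hacc t ht)
  · have h := det_mul_normSq_add a b
    rw [hdet, htan, h2, h3] at h
    rw [X₁_eq] at h1
    rw [eq_div_iff (by positivity), ← h1]
    linarith
  · intro hK
    have hlam : ∀ t, lam t = 0 := fun t => by
      have := hA.multiplier_eq hl t
      rw [hK, mul_zero] at this
      exact (mul_eq_zero.1 this).resolve_right (pow_pos (hA.norm_pos t) 4).ne'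
    have hvel : ∀ t, deriv A t = deriv A 0 := fun t =>
      is_const_of_deriv_eq_zero (fun t => (hA.hasDerivAt_deriv t).differentiableAt)
        (fun t => (hl t).trans (by rw [hlam, zero_smul])) t 0
    have hline : ∀ t : ℝ, A t = t • deriv A 0 + A 0 := fun t => by
      have hd : ∀ s : ℝ, HasDerivAt (fun s => A s - s • deriv A 0) 0 s := fun s => by
        have := (hA.hasDerivAt s).fun_sub ((hasDerivAt_id s).smul_const (deriv A 0))
        rw [one_smul] at this
        exact this.congr_deriv (sub_eq_zero.2 (hvel s))
      have := is_const_of_deriv_eq_zero (fun s => (hd s).differentiableAt)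
        (fun s => (hd s).deriv) t 0
      simp only [zero_smul, sub_zero] at this
      rw [← this]
      abel
    have heq : (a, b) = (A 0, deriv A 0) := (huniq _ _ (by
      refine tendsto_const_nhds.congr fun t => ?_
      rw [← hline t, sub_self, norm_zero])).symm
    exact ⟨heq, heq ▸ hD, hline⟩
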